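/- For $0<p\le\infty$ and a positive integer $n$, let $\ell_p^n$ be $\mathbb{R}^n$ with the (quasi-)norm $\|x\|_p=\bigl(\sum_{i=1}^n|x_i|^p\bigr)^{1/p}$ if $p<\infty$ and $\|x\|_\infty=\max_{1\le i\le n}|x_i|$, and let $B_p^n=\{x\in\mathbb{R}^n:\|x\|_p\le 1\}$. For $0<p,q\le\infty$ and an integer $k\ge1$, the $k$-th (dyadic) entropy number of the identity $\mathrm{id}:\ell_p^n\to\ell_q^n$ is $$e_k(\mathrm{id}:\ell_p^n\to\ell_q^n)=\inf\Bigl\{r>0:\ \exists\, y_1,\dots,y_{2^{k-1}}\in\mathbb{R}^n\ \text{with}\ B_p^n\subset\bigcup_{j=1}^{2^{k-1}}(y_j+rB_q^n)\Bigr\}.$$ Let $0<p,q\le\infty$, and put $1/\infty=0$. There are constants $c,C>0$, depending only on $p$ and $q$, such that, writing $e_k=e_k(\mathrm{id}:\ell_p^n\to\ell_q^n)$, the following holds for all integers $n,k\ge1$. (a) If $p\le q$, then $c\,\beta\le e_k\le C\,\beta$, where $$\beta=\begin{cases}1 & \text{if } 1\le k\le\log_2 n,\\ \Bigl(\dfrac{\log_2(1+n/k)}{k}\Bigr)^{1/p-1/q}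 & \text{if } \log_2 n\le k\le n,\\ 2^{-(k-1)/n}\,n^{1/q-1/p} & \text{if } k\ge n;\end{cases}$$ where two of these ranges overlap, the estimate holds with either value of $\beta$. (b) If $q\le p$, then $c\,2^{-(k-1)/n}\,n^{1/q-1/p}\le e_k\le C\,2^{-(k-1)/n}\,n^{1/q-1/p}$. -/

import Mathlib

open scoped ENNReal Pointwise

noncomputable section

/-- The closed unit ball `B_X = {x | ‖x‖ ≤ 1}`. Only the function `‖·‖` is used, so that this makes
sense for quasi-norms (`Norm` carries no triangle inequality). -/
def quasiUnitBall (X : Type*) [Norm X] : Set X := {x | ‖x‖ ≤ 1}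

/-- The `k`-th dyadic entropy number (`k ≥ 1`) of a linear operator `T : X → Y`: the infimum of all
`r > 0` such that `T(B_X)` is covered by `2^(k-1)` translates of `r B_Y`. -/
def entropyNumber {X Y : Type*} [AddCommGroup X] [Module ℝ X] [Norm X]
    [AddCommGroup Y] [Module ℝ Y] [Norm Y] (k : ℕ) (T : X →ₗ[ℝ] Y) : ℝ :=
  sInf {r : ℝ | 0 < r ∧ ∃ y : Fin (2 ^ (k - 1)) → Y,
    T '' quasiUnitBall X ⊆ ⋃ j, (y j +ᵥ r • quasiUnitBall Y)}

/-- The real space `ℓ_p^n`, for every `0 < p ≤ ∞`. Its norm in Mathlib is `(∑ |x i| ^ p) ^ (1 / p)`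
for `0 < p < ∞` and `max |x i|` for `p = ∞`, also when `p < 1`. -/
abbrev lpSpace (p : ℝ≥0∞) (n : ℕ) : Type := PiLp p (fun _ : Fin n => ℝ)

/-- The identity `ℓ_p^n → ℓ_q^n`. -/
def lpId (p q : ℝ≥0∞) (n : ℕ) : lpSpace p n →ₗ[ℝ] lpSpace q n :=
  ((WithLp.linearEquiv p ℝ (Fin n → ℝ)).trans
    (WithLp.linearEquiv q ℝ (Fin n → ℝ)).symm).toLinearMap

/-- The exponent `1/p`, with `1/∞ = 0`. -/
def recip (p : ℝ≥0∞) : ℝ := (p⁻¹).toReal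

end

/-! All upper bounds come from explicit nets, all lower bounds from volume or packing; no triangle
inequality is needed, so `p, q < 1` costs nothing extra.

Upper bounds for `p ≤ q`: round each coordinate of a point of `B_p^n` towards zero to a multiple of
`h`. The rounded point and the error are dominated coordinatewise by the original, so both stay in
`B_p^n`, and the error has entries at most `h`. The points of `hℤ^n` in `B_p^n` are counted by an
exponential moment (`card_lattice_points_le`). For `k ≥ n`, `h` is of order `2^(-(k-1)/n) n^(-1/p)`
and the error is at most `h n^(1/q)`. For `k ≤ n`, `h = m^(-1/p)` with `m` of order `k /
log(1+n/k)`: lattice points have at most `m` nonzero entries, and interpolation bounds the error by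
`m^(-(1/p-1/q))`.

Lower bounds: comparing volumes gives `2^(-(k-1)/n) n^(1/q-1/p)` for all `p, q`. For `k ≤ log₂ n`
the unit vectors are too many and too far apart. In between, flat vectors on transversals of `m`
blocks of length about `n/m` form a large packing (`le_entropyNumber_of_blocks`), and for `k`
comparable with `n` volume suffices.

For `q ≤ p` the inclusion `B_p^n ⊆ n^(1/q-1/p) B_q^n` reduces the upper bound to `p = q`. -/

open MeasureTheory

/-! ### Balls of `ℓ_p^n` and inclusions between them -/

/-- The closed ball of radius `r` of `ℓ_p^n`, as a set of functions. -/
def lpBall (p : ℝ≥0∞) (n : ℕ) (r : ℝ) : Set (Fin n → ℝ) :=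
  {x | ‖(WithLp.toLp p x : lpSpace p n)‖ ≤ r}

theorem recip_eq_inv_toReal (p : ℝ≥0∞) : recip p = (p.toReal)⁻¹ := ENNReal.toReal_inv p

theorem recip_nonneg (p : ℝ≥0∞) : 0 ≤ recip p := ENNReal.toReal_nonneg

theorem recip_top : recip ⊤ = 0 := by simp [recip]

theorem recip_le_recip {p q : ℝ≥0∞} (hp : 0 < p) (hpq : p ≤ q) : recip q ≤ recip p :=
  ENNReal.toReal_mono (by simpa using hp.ne') (ENNReal.inv_le_inv.2 hpq)

theorem mem_lpBall_top {n : ℕ} {r : ℝ} (hr : 0 ≤ r) {x : Fin n → ℝ} :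
    x ∈ lpBall ⊤ n r ↔ ∀ i, |x i| ≤ r := by
  simp only [lpBall, Set.mem_ofPred_eq, PiLp.norm_eq_ciSup, Real.norm_eq_abs]
  constructor
  · intro h i
    exact (le_ciSup (f := fun i => |x i|) (Set.finite_range _).bddAbove i).trans h
  · intro h
    exact Real.iSup_le h hr

theorem mem_lpBall_iff_sum {p : ℝ≥0∞} (hp : 0 < p.toReal) {n : ℕ} {r : ℝ} (hr : 0 ≤ r)
    {x : Fin n → ℝ} : x ∈ lpBall p n r ↔ ∑ i, |x i| ^ p.toReal ≤ r ^ p.toReal := by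
  have hs : 0 ≤ ∑ i, |x i| ^ p.toReal :=
    Finset.sum_nonneg fun i _ => Real.rpow_nonneg (abs_nonneg _) _
  simp only [lpBall, Set.mem_ofPred_eq, PiLp.norm_eq_sum hp, Real.norm_eq_abs, one_div]
  exact Real.rpow_inv_le_iff_of_pos hs hr hp

theorem smul_mem_lpBall_iff {p : ℝ≥0∞} (hp : 0 < p) {n : ℕ} {c r : ℝ} (hc : 0 < c) (hr : 0 ≤ r)
    {x : Fin n → ℝ} : c • x ∈ lpBall p n (c * r) ↔ x ∈ lpBall p n r := by
  rcases eq_or_ne p ⊤ with rfl | hpt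
  · rw [mem_lpBall_top (by positivity), mem_lpBall_top hr]
    simp [abs_mul, abs_of_pos hc, hc]
  · have hp' := ENNReal.toReal_pos hp.ne' hpt
    rw [mem_lpBall_iff_sum hp' (by positivity), mem_lpBall_iff_sum hp' hr]
    simp only [Pi.smul_apply, smul_eq_mul, abs_mul, abs_of_pos hc]
    simp only [Real.mul_rpow hc.le (abs_nonneg _), Real.mul_rpow hc.le hr]
    rw [← Finset.mul_sum]
    exact mul_le_mul_iff_right₀ (Real.rpow_pos_of_pos hc _)

theorem smul_lpBall {p : ℝ≥0∞} (hp : 0 < p) {n : ℕ} {c r : ℝ} (hc : 0 < c) (hr : 0 ≤ r) :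
    c • lpBall p n r = lpBall p n (c * r) := by
  ext x
  rw [Set.mem_smul_set_iff_inv_smul_mem₀ hc.ne', ← smul_mem_lpBall_iff hp hc hr,
    smul_inv_smul₀ hc.ne']

theorem abs_apply_le_of_mem_lpBall {p : ℝ≥0∞} (hp : 0 < p) {n : ℕ} {r : ℝ} (hr : 0 ≤ r)
    {x : Fin n → ℝ} (hx : x ∈ lpBall p n r) (i : Fin n) : |x i| ≤ r := by
  rcases eq_or_ne p ⊤ with rfl | hpt
  · exact (mem_lpBall_top hr).1 hx i
  · have hp' := ENNReal.toReal_pos hp.ne' hpt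
    rw [mem_lpBall_iff_sum hp' hr] at hx
    rw [← Real.rpow_le_rpow_iff (abs_nonneg _) hr hp']
    refine le_trans ?_ hx
    exact Finset.single_le_sum (f := fun i => |x i| ^ p.toReal)
      (fun i _ => Real.rpow_nonneg (abs_nonneg _) _) (Finset.mem_univ i)

theorem mem_lpBall_of_abs_le {p : ℝ≥0∞} (hp : 0 < p) {n : ℕ} {r : ℝ} (hr : 0 ≤ r)
    {x y : Fin n → ℝ} (hx : x ∈ lpBall p n r) (hy : ∀ i, |y i| ≤ |x i|) : y ∈ lpBall p n r := by
  rcases eq_or_ne p ⊤ with rfl | hpt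
  · rw [mem_lpBall_top hr] at hx ⊢
    exact fun i => (hy i).trans (hx i)
  · have hp' := ENNReal.toReal_pos hp.ne' hpt
    rw [mem_lpBall_iff_sum hp' hr] at hx ⊢
    refine le_trans (Finset.sum_le_sum fun i _ => ?_) hx
    exact Real.rpow_le_rpow (abs_nonneg _) (hy i) hp'.le

/-- A vector with entries bounded by `h` has `ℓ_q` norm at most `h n^(1/q)`. -/
theorem mem_lpBall_of_forall_abs_le {q : ℝ≥0∞} (hq : 0 < q) {n : ℕ} {h : ℝ} (hh : 0 ≤ h)
    {x : Fin n → ℝ} (hx : ∀ i, |x i| ≤ h) : x ∈ lpBall q n (h * (n : ℝ) ^ recip q) := by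
  rcases eq_or_ne q ⊤ with rfl | hqt
  · rw [mem_lpBall_top (by positivity)]
    simpa [recip_top] using hx
  · have hq' := ENNReal.toReal_pos hq.ne' hqt
    rw [mem_lpBall_iff_sum hq' (by positivity), Real.mul_rpow hh (by positivity),
      recip_eq_inv_toReal, Real.rpow_inv_rpow (by positivity) hq'.ne']
    calc ∑ i, |x i| ^ q.toReal ≤ ∑ _i : Fin n, h ^ q.toReal :=
          Finset.sum_le_sum fun i _ => Real.rpow_le_rpow (abs_nonneg _) (hx i) hq'.le
      _ = _ := by simp [mul_comm]

/-- Interpolation between `ℓ_p` and `ℓ_∞`. -/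
theorem mem_lpBall_interpolation {p q : ℝ≥0∞} (hp : 0 < p) (hpt : p ≠ ⊤) (hpq : p ≤ q) {n : ℕ}
    {h : ℝ} (hh : 0 < h) {x : Fin n → ℝ} (hx : x ∈ lpBall p n 1) (hxh : ∀ i, |x i| ≤ h) :
    x ∈ lpBall q n (h ^ (p.toReal * (recip p - recip q))) := by
  have hp' := ENNReal.toReal_pos hp.ne' hpt
  rcases eq_or_ne q ⊤ with rfl | hqt
  · rw [mem_lpBall_top (by positivity), recip_top, recip_eq_inv_toReal, sub_zero,
      mul_inv_cancel₀ hp'.ne', Real.rpow_one]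
    exact hxh
  · have hq' := ENNReal.toReal_pos (hp.trans_le hpq).ne' hqt
    have hpq' : p.toReal ≤ q.toReal := ENNReal.toReal_mono hqt hpq
    rw [mem_lpBall_iff_sum hp' zero_le_one, Real.one_rpow] at hx
    rw [mem_lpBall_iff_sum hq' (by positivity), ← Real.rpow_mul hh.le]
    have he : p.toReal * (recip p - recip q) * q.toReal = q.toReal - p.toReal := by
      rw [recip_eq_inv_toReal, recip_eq_inv_toReal]; field_simp
    rw [he]
    calc ∑ i, |x i| ^ q.toReal ≤ ∑ i, h ^ (q.toReal - p.toReal) * |x i| ^ p.toReal := by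
          refine Finset.sum_le_sum fun i _ => ?_
          have : |x i| ^ q.toReal = |x i| ^ (q.toReal - p.toReal) * |x i| ^ p.toReal := by
            rw [← Real.rpow_add_of_nonneg (abs_nonneg _) (by linarith) hp'.le]; simp
          rw [this]
          exact mul_le_mul_of_nonneg_right
            (Real.rpow_le_rpow (abs_nonneg _) (hxh i) (by linarith)) (by positivity)
      _ = h ^ (q.toReal - p.toReal) * ∑ i, |x i| ^ p.toReal := by rw [Finset.mul_sum]
      _ ≤ _ := mul_le_of_le_one_right (by positivity) hx

theorem lpBall_one_subset_of_le {p q : ℝ≥0∞} (hp : 0 < p) (hpq : p ≤ q) (n : ℕ) :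
    lpBall p n 1 ⊆ lpBall q n 1 := by
  intro x hx
  rcases eq_or_ne p ⊤ with rfl | hpt
  · rwa [top_le_iff.1 hpq]
  · simpa using mem_lpBall_interpolation hp hpt hpq one_pos hx
      (abs_apply_le_of_mem_lpBall hp zero_le_one hx)

/-- Power mean inequality with exponent `p / q ≥ 1`, applied to the numbers `|x i| ^ q`. -/
theorem lpBall_one_subset_of_ge {p q : ℝ≥0∞} (hq : 0 < q) (hqp : q ≤ p) {n : ℕ} (hn : 1 ≤ n) :
    lpBall p n 1 ⊆ lpBall q n ((n : ℝ) ^ (recip q - recip p)) := by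
  intro x hx
  have hn' : (0 : ℝ) < n := by exact_mod_cast hn
  rcases eq_or_ne p ⊤ with rfl | hpt
  · simpa [recip_top] using
      mem_lpBall_of_forall_abs_le hq zero_le_one ((mem_lpBall_top zero_le_one).1 hx)
  · have hp' := ENNReal.toReal_pos (hq.trans_le hqp).ne' hpt
    have hq' := ENNReal.toReal_pos hq.ne' (ne_top_of_le_ne_top hpt hqp)
    have hqp' : q.toReal ≤ p.toReal := ENNReal.toReal_mono hpt hqp
    rw [mem_lpBall_iff_sum hp' zero_le_one, Real.one_rpow] at hx
    rw [mem_lpBall_iff_sum hq' (by positivity)]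
    have key := Real.rpow_sum_le_const_mul_sum_rpow_of_nonneg (Finset.univ : Finset (Fin n))
      (f := fun i => |x i| ^ q.toReal) (p := p.toReal / q.toReal)
      ((one_le_div hq').2 hqp') (fun i _ => by positivity)
    simp only [← Real.rpow_mul (abs_nonneg _), mul_div_cancel₀ _ hq'.ne', Finset.card_univ,
      Fintype.card_fin] at key
    have hS : 0 ≤ ∑ i, |x i| ^ q.toReal := Finset.sum_nonneg fun i _ => by positivity
    have key2 := key.trans (mul_le_of_le_one_right (by positivity) hx)
    rw [← Real.rpow_le_rpow_iff hS (by positivity) (div_pos hp' hq')]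
    refine key2.trans_eq ?_
    rw [← Real.rpow_mul hn'.le, ← Real.rpow_mul hn'.le]
    congr 1
    rw [recip_eq_inv_toReal, recip_eq_inv_toReal]; field_simp

/-! ### Entropy numbers as covering radii -/

theorem mem_vadd_smul_quasiUnitBall {q : ℝ≥0∞} (hq : 0 < q) {n : ℕ} {r : ℝ} (hr : 0 < r)
    (x y : Fin n → ℝ) :
    (WithLp.toLp q x : lpSpace q n) ∈
      ((WithLp.toLp q y : lpSpace q n) +ᵥ r • quasiUnitBall (lpSpace q n)) ↔
      x - y ∈ lpBall q n r := by
  rw [Set.mem_vadd_set_iff_neg_vadd_mem, Set.mem_smul_set_iff_inv_smul_mem₀ hr.ne',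
    ← smul_mem_lpBall_iff hq (inv_pos.2 hr) hr.le, inv_mul_cancel₀ hr.ne', sub_eq_neg_add]
  rfl

/-- The image of the unit ball under the identity is covered by the translates of `r B_q`
centred at `y j`. -/
theorem lpId_image_subset_iff {p q : ℝ≥0∞} (hq : 0 < q) {n : ℕ} {r : ℝ} (hr : 0 < r)
    {N : ℕ} (y : Fin N → lpSpace q n) :
    lpId p q n '' quasiUnitBall (lpSpace p n) ⊆ ⋃ j, (y j +ᵥ r • quasiUnitBall (lpSpace q n)) ↔
      ∀ x ∈ lpBall p n 1, ∃ j, x - (y j).ofLp ∈ lpBall q n r := by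
  constructor
  · intro h x hx
    have := h ⟨WithLp.toLp p x, hx, rfl⟩
    obtain ⟨j, hj⟩ := Set.mem_iUnion.1 this
    exact ⟨j, (mem_vadd_smul_quasiUnitBall hq hr x (y j).ofLp).1 hj⟩
  · rintro h _ ⟨x, hx, rfl⟩
    obtain ⟨j, hj⟩ := h x.ofLp hx
    exact Set.mem_iUnion.2 ⟨j, (mem_vadd_smul_quasiUnitBall hq hr x.ofLp (y j).ofLp).2 hj⟩

theorem entropyNumber_lpId_le {p q : ℝ≥0∞} (hq : 0 < q) {n k : ℕ} {r : ℝ} (hr : 0 < r)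
    (Y : Finset (Fin n → ℝ)) (hY : Y.card ≤ 2 ^ (k - 1))
    (hcov : ∀ x ∈ lpBall p n 1, ∃ y ∈ Y, x - y ∈ lpBall q n r) :
    entropyNumber k (lpId p q n) ≤ r := by
  refine csInf_le ⟨0, fun s hs => hs.1.le⟩ ⟨hr, ?_⟩
  -- If `Y` has fewer than `2^(k-1)` points, the list of centres is padded with `0`.
  let f : Fin (2 ^ (k - 1)) → lpSpace q n := fun j =>
    WithLp.toLp q (if h : j.1 < Y.card then (Y.equivFin.symm ⟨j, h⟩).1 else 0)
  refine ⟨f, (lpId_image_subset_iff hq hr f).2 fun x hx => ?_⟩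
  obtain ⟨y, hy, hxy⟩ := hcov x hx
  refine ⟨⟨Y.equivFin ⟨y, hy⟩, (Fin.is_lt _).trans_le hY⟩, ?_⟩
  simpa [f] using hxy

theorem lpBall_mono {p : ℝ≥0∞} {n : ℕ} {r s : ℝ} (h : r ≤ s) : lpBall p n r ⊆ lpBall p n s :=
  fun _ hx => le_trans hx h

/-- A lower bound for every radius of a covering is a lower bound for the entropy number. -/
theorem le_entropyNumber_lpId {p q : ℝ≥0∞} (hp : 0 < p) (hq : 0 < q) {n k : ℕ} {c : ℝ}
    (h : ∀ r : ℝ, 0 < r → ∀ y : Fin (2 ^ (k - 1)) → Fin n → ℝ,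
      (∀ x ∈ lpBall p n 1, ∃ j, x - y j ∈ lpBall q n r) → c ≤ r) :
    c ≤ entropyNumber k (lpId p q n) := by
  refine le_csInf ?_ ?_
  -- Some radius is admissible, so the infimum is not over the empty set. The `+ 1` keeps the radius
  -- positive when `n = 0`.
  · refine ⟨1 * (n : ℝ) ^ recip q + 1, by positivity, fun _ => 0,
      (lpId_image_subset_iff hq (by positivity) _).2 fun x hx => ⟨⟨0, by positivity⟩, ?_⟩⟩
    simp only [WithLp.ofLp_zero, sub_zero]
    exact lpBall_mono (by linarith) (mem_lpBall_of_forall_abs_le hq zero_le_one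
      (abs_apply_le_of_mem_lpBall hp zero_le_one hx))
  · rintro r ⟨hr, y, hy⟩
    exact h r hr (fun j => (y j).ofLp) ((lpId_image_subset_iff hq hr y).1 hy)

theorem entropyNumber_lpId_le_one {p q : ℝ≥0∞} (hp : 0 < p) (hpq : p ≤ q) (n k : ℕ) :
    entropyNumber k (lpId p q n) ≤ 1 := by
  refine entropyNumber_lpId_le (hp.trans_le hpq) one_pos {0} ?_ fun x hx => ⟨0, by simp, ?_⟩
  · simpa using Nat.one_le_two_pow
  · simpa using lpBall_one_subset_of_le hp hpq n hx

theorem entropyNumber_lpId_antitone {p q : ℝ≥0∞} (hp : 0 < p) (hq : 0 < q) {n k l : ℕ}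
    (hkl : k ≤ l) : entropyNumber l (lpId p q n) ≤ entropyNumber k (lpId p q n) := by
  classical
  refine le_entropyNumber_lpId hp hq fun r hr y hy => ?_
  refine entropyNumber_lpId_le hq hr (Finset.univ.image y) ?_ fun x hx => ?_
  · exact Finset.card_image_le.trans
      (by simpa using Nat.pow_le_pow_right two_pos (Nat.sub_le_sub_right hkl 1))
  · obtain ⟨j, hj⟩ := hy x hx
    exact ⟨y j, Finset.mem_image_of_mem _ (Finset.mem_univ j), hj⟩

/-- For `q ≤ p`, the identity `ℓ_p^n → ℓ_q^n` factors through `ℓ_q^n → ℓ_q^n`. -/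
theorem entropyNumber_lpId_le_mul {p q : ℝ≥0∞} (hq : 0 < q) (hqp : q ≤ p) {n k : ℕ}
    (hn : 1 ≤ n) : entropyNumber k (lpId p q n) ≤
      (n : ℝ) ^ (recip q - recip p) * entropyNumber k (lpId q q n) := by
  classical
  have hn' : (0 : ℝ) < n := by exact_mod_cast hn
  set t : ℝ := (n : ℝ) ^ (recip q - recip p) with ht
  have ht0 : 0 < t := Real.rpow_pos_of_pos hn' _
  rw [← div_le_iff₀' ht0]
  refine le_entropyNumber_lpId hq hq fun r hr y hy => ?_
  rw [div_le_iff₀' ht0]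
  refine entropyNumber_lpId_le hq (by positivity) (Finset.univ.image fun j => t • y j) ?_
    fun x hx => ?_
  · exact Finset.card_image_le.trans (by simp)
  · have hx' : t⁻¹ • x ∈ lpBall q n 1 := by
      rw [← smul_mem_lpBall_iff hq ht0 zero_le_one, smul_inv_smul₀ ht0.ne', mul_one]
      exact lpBall_one_subset_of_ge hq hqp hn hx
    obtain ⟨j, hj⟩ := hy _ hx'
    refine ⟨_, Finset.mem_image_of_mem _ (Finset.mem_univ j), ?_⟩
    rw [← smul_mem_lpBall_iff hq ht0 hr.le, smul_sub, smul_inv_smul₀ ht0.ne'] at hj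
    exact hj

/-! ### Volume estimates and the volume lower bound -/

theorem integrable_exp_neg_abs_rpow {s : ℝ} (hs : 0 < s) :
    Integrable fun t : ℝ => Real.exp (-|t| ^ s) := by
  have h := integrableOn_rpow_mul_exp_neg_rpow (s := 0) (p := s) (by norm_num) hs
  have h' : IntegrableOn (fun t : ℝ => Real.exp (-t ^ s)) (Set.Ioi 0) := by simpa using h
  have hpos : IntegrableOn (fun t : ℝ => Real.exp (-|t| ^ s)) (Set.Ioi 0) :=
    h'.congr_fun (fun t ht => by rw [abs_of_pos ht]) measurableSet_Ioi
  have hneg : IntegrableOn (fun t : ℝ => Real.exp (-|t| ^ s)) (Set.Iic 0) := by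
    have h0 := (integrableOn_Ici_iff_integrableOn_Ioi).2 hpos
    simpa using (IntegrableOn.comp_neg_Iic (f := fun t : ℝ => Real.exp (-|t| ^ s)) (c := 0)
      (by simpa using h0))
  rw [← integrableOn_univ, ← Set.Iic_union_Ioi (a := (0 : ℝ))]
  exact hneg.union hpos

theorem integral_exp_neg_abs_rpow_pos {s : ℝ} (hs : 0 < s) :
    0 < ∫ t : ℝ, Real.exp (-|t| ^ s) :=
  integral_exp_pos (integrable_exp_neg_abs_rpow hs)

/-- Upper bound for the volume of `n^(1/q) B_q^n`. -/
theorem exists_volume_lpBall_le {q : ℝ≥0∞} (hq : 0 < q) : ∃ C : ℝ, 0 < C ∧ ∀ n : ℕ,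
    volume (lpBall q n ((n : ℝ) ^ recip q)) ≤ ENNReal.ofReal (C ^ n) := by
  rcases eq_or_ne q ⊤ with rfl | hqt
  · refine ⟨2, two_pos, fun n => ?_⟩
    have : lpBall ⊤ n ((n : ℝ) ^ recip ⊤) = Set.Icc (fun _ => -1) (fun _ => 1) := by
      ext x
      rw [mem_lpBall_top (by positivity), recip_top, Real.rpow_zero]
      simp only [abs_le, Set.mem_Icc, Pi.le_def]
      exact forall_and
    rw [this, Real.volume_Icc_pi]
    norm_num [ENNReal.ofReal_pow]
  · have hq' := ENNReal.toReal_pos hq.ne' hqt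
    set s := q.toReal
    set I := ∫ t : ℝ, Real.exp (-|t| ^ s) with hI
    refine ⟨Real.exp 1 * I, mul_pos (Real.exp_pos 1) (integral_exp_neg_abs_rpow_pos hq'),
      fun n => ?_⟩
    have hint : Integrable (fun x : Fin n → ℝ => ∏ i, Real.exp (-|x i| ^ s)) :=
      Integrable.fintype_prod fun _ => integrable_exp_neg_abs_rpow hq'
    -- Markov's inequality at level `e^(-n)`: the ball is `∑ |x i|^q ≤ n`, where the product is at
    -- least `e^(-n)`, and the integral factorizes as `I^n`.
    have hM := mul_meas_ge_le_integral_of_nonneg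
      (.of_forall fun x : Fin n → ℝ => Finset.prod_nonneg fun i _ => (Real.exp_pos _).le)
      hint (Real.exp (-n))
    rw [integral_fintype_prod_volume_eq_pow (fun t : ℝ => Real.exp (-|t| ^ s)),
      Fintype.card_fin, ← hI] at hM
    have hsub : lpBall q n ((n : ℝ) ^ recip q) ⊆
        {x | Real.exp (-n) ≤ ∏ i, Real.exp (-|x i| ^ s)} := by
      intro x hx
      rw [mem_lpBall_iff_sum hq' (by positivity), recip_eq_inv_toReal,
        Real.rpow_inv_rpow (by positivity) hq'.ne'] at hx
      change Real.exp (-n) ≤ ∏ i, Real.exp (-|x i| ^ s)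
      rw [← Real.exp_sum, Finset.sum_neg_distrib]
      exact Real.exp_le_exp.2 (neg_le_neg hx)
    refine (measure_mono hsub).trans ?_
    have hfin : volume {x : Fin n → ℝ | Real.exp (-n) ≤ ∏ i, Real.exp (-|x i| ^ s)} ≠ ⊤ :=
      (hint.measure_ge_lt_top (Real.exp_pos _)).ne
    rw [← ENNReal.ofReal_toReal hfin]
    refine ENNReal.ofReal_le_ofReal ?_
    rw [mul_pow, ← Real.exp_nat_mul, mul_one]
    calc _ = Real.exp n * (Real.exp (-n) *
          volume.real {x : Fin n → ℝ | Real.exp (-n) ≤ ∏ i, Real.exp (-|x i| ^ s)}) := by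
          rw [← mul_assoc, ← Real.exp_add, add_neg_cancel, Real.exp_zero, one_mul]
          rfl
      _ ≤ _ := by gcongr

/-- Lower bound for the volume of the unit ball, which contains a cube. -/
theorem le_volume_lpBall {p : ℝ≥0∞} (hp : 0 < p) {n : ℕ} (hn : 1 ≤ n) :
    ENNReal.ofReal (((n : ℝ) ^ (-recip p)) ^ n) ≤ volume (lpBall p n 1) := by
  have hn' : (0 : ℝ) < n := by exact_mod_cast hn
  set h : ℝ := (n : ℝ) ^ (-recip p) with hh
  have h0 : 0 < h := Real.rpow_pos_of_pos hn' _
  have hsub : Set.Icc (fun _ => 0) (fun _ => h) ⊆ lpBall p n 1 := by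
    intro x hx
    have := mem_lpBall_of_forall_abs_le hp h0.le (x := x) fun i =>
      abs_le.2 ⟨by linarith [hx.1 i], hx.2 i⟩
    rwa [hh, ← Real.rpow_add hn', neg_add_cancel, Real.rpow_zero] at this
  refine le_trans ?_ (measure_mono hsub)
  rw [Real.volume_Icc_pi]
  simp [ENNReal.ofReal_pow h0.le]

/-- The volume lower bound for entropy numbers. -/
theorem exists_volume_le_entropyNumber {p q : ℝ≥0∞} (hp : 0 < p) (hq : 0 < q) :
    ∃ c : ℝ, 0 < c ∧ ∀ n k : ℕ, 1 ≤ n → 1 ≤ k →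
      c * ((2 : ℝ) ^ (-(((k : ℝ) - 1) / (n : ℝ))) * (n : ℝ) ^ (recip q - recip p))
        ≤ entropyNumber k (lpId p q n) := by
  obtain ⟨C, hC, hvol⟩ := exists_volume_lpBall_le hq
  refine ⟨C⁻¹, inv_pos.2 hC, fun n k hn hk => le_entropyNumber_lpId hp hq fun r hr y hy => ?_⟩
  have hn' : (0 : ℝ) < n := by exact_mod_cast hn
  set R : ℝ := (n : ℝ) ^ recip q with hR
  have hR0 : 0 < R := Real.rpow_pos_of_pos hn' _
  have hball : volume (lpBall q n r) ≤ ENNReal.ofReal ((r / R * C) ^ n) := by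
    have : lpBall q n r = (r / R) • lpBall q n R := by
      rw [smul_lpBall hq (div_pos hr hR0) hR0.le, div_mul_cancel₀ _ hR0.ne']
    rw [this, Measure.addHaar_smul_of_nonneg _ (by positivity), mul_pow,
      ENNReal.ofReal_mul (by positivity)]
    simpa using mul_le_mul_right (hvol n) _
  have hcover : lpBall p n 1 ⊆ ⋃ j, (y j +ᵥ lpBall q n r) := by
    intro x hx
    obtain ⟨j, hj⟩ := hy x hx
    refine Set.mem_iUnion.2 ⟨j, ?_⟩
    rw [Set.mem_vadd_set_iff_neg_vadd_mem, vadd_eq_add, ← sub_eq_neg_add]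
    exact hj
  have hmain : ENNReal.ofReal (((n : ℝ) ^ (-recip p)) ^ n) ≤
      ENNReal.ofReal (2 ^ (k - 1) * (r / R * C) ^ n) := by
    calc _ ≤ volume (lpBall p n 1) := le_volume_lpBall hp hn
      _ ≤ volume (⋃ j, (y j +ᵥ lpBall q n r)) := measure_mono hcover
      _ ≤ ∑ j, volume (y j +ᵥ lpBall q n r) := measure_iUnion_fintype_le _ _
      _ = 2 ^ (k - 1) * volume (lpBall q n r) := by simp [measure_vadd]
      _ ≤ 2 ^ (k - 1) * ENNReal.ofReal ((r / R * C) ^ n) := mul_le_mul_right hball _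
      _ = _ := by rw [ENNReal.ofReal_mul (by positivity)]; norm_num [ENNReal.ofReal_pow]
  rw [ENNReal.ofReal_le_ofReal_iff (by positivity)] at hmain
  -- `T` is the `n`-th root of the number of balls, so that `n`-th roots can be taken in `hmain`.
  set T : ℝ := (2 : ℝ) ^ (((k : ℝ) - 1) / (n : ℝ)) with hT
  have hT0 : 0 < T := by positivity
  have hTn : T ^ n = 2 ^ (k - 1) := by
    rw [hT, ← Real.rpow_natCast, ← Real.rpow_mul two_pos.le, div_mul_cancel₀ _ hn'.ne',
      ← Real.rpow_natCast 2 (k - 1), Nat.cast_sub hk, Nat.cast_one]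
  rw [← hTn, ← mul_pow, pow_le_pow_iff_left₀ (by positivity) (by positivity) (by lia)] at hmain
  rw [Real.rpow_neg two_pos.le, sub_eq_add_neg (recip q), Real.rpow_add hn', ← hR, ← hT]
  calc C⁻¹ * (T⁻¹ * (R * (n : ℝ) ^ (-recip p))) ≤ C⁻¹ * (T⁻¹ * (R * (T * (r / R * C)))) := by
        gcongr
    _ = r := by field_simp

/-! ### Rounding to a lattice and counting lattice points -/

/-- Rounding a real number to an integer, towards zero. -/
theorem exists_int_round_toward_zero (t : ℝ) :
    ∃ z : ℤ, |t - z| ≤ 1 ∧ |t - z| ≤ |t| ∧ |(z : ℝ)| ≤ |t| := by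
  rcases le_total 0 t with ht | ht
  · have h1 := Int.floor_le t
    have h2 := Int.lt_floor_add_one t
    have h3 : (0 : ℝ) ≤ ⌊t⌋ := by exact_mod_cast Int.floor_nonneg.2 ht
    refine ⟨⌊t⌋, ?_, ?_, ?_⟩ <;>
      simp only [abs_of_nonneg ht, abs_of_nonneg h3, abs_of_nonneg (sub_nonneg.2 h1)] <;> linarith
  · have h1 := Int.le_ceil t
    have h2 := Int.ceil_lt_add_one t
    have h3 : (⌈t⌉ : ℝ) ≤ 0 := by exact_mod_cast Int.ceil_le.2 (by simpa using ht)
    refine ⟨⌈t⌉, ?_, ?_, ?_⟩ <;>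
      simp only [abs_of_nonpos ht, abs_of_nonpos h3, abs_of_nonpos (sub_nonpos.2 h1)] <;> linarith

theorem sum_Icc_neg_natAbs (g : ℕ → ℝ) (M : ℕ) :
    ∑ z ∈ Finset.Icc (-(M : ℤ)) M, g z.natAbs = g 0 + 2 * ∑ i ∈ Finset.range M, g (i + 1) := by
  induction M with
  | zero => simp
  | succ M ih =>
    have h : Finset.Icc (-((M + 1 : ℕ) : ℤ)) ((M + 1 : ℕ) : ℤ) =
        insert ((M + 1 : ℕ) : ℤ) (insert (-((M + 1 : ℕ) : ℤ)) (Finset.Icc (-(M : ℤ)) M)) := by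
      ext z
      simp only [Finset.mem_Icc, Finset.mem_insert]
      lia
    rw [h, Finset.sum_insert, Finset.sum_insert, ih, Finset.sum_range_succ, Int.natAbs_neg,
      Int.natAbs_natCast]
    · ring
    · simp only [Finset.mem_Icc]; lia
    · simp only [Finset.mem_Icc, Finset.mem_insert]; lia

/-- The function `exp (-|δ t|^s)` decreases on `t ≥ 0`, so its sum over positive integers is at most
its integral. -/
theorem sum_range_exp_neg_rpow_le {s δ : ℝ} (hs : 0 < s) (hδ : 0 < δ) (M : ℕ) :
    ∑ i ∈ Finset.range M, Real.exp (-(|δ * ((i + 1 : ℕ) : ℝ)| ^ s)) ≤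
      (∫ t : ℝ, Real.exp (-|t| ^ s)) / δ := by
  set f : ℝ → ℝ := fun t => Real.exp (-|δ * t| ^ s) with hf
  have hint : Integrable f := (integrable_exp_neg_abs_rpow hs).comp_mul_left' hδ.ne'
  have hanti : AntitoneOn f (Set.Icc 0 (0 + (M : ℝ))) := by
    intro a ha b hb hab
    have ha0 : 0 ≤ δ * a := mul_nonneg hδ.le ha.1
    have hb0 : 0 ≤ δ * b := mul_nonneg hδ.le hb.1
    simp only [hf, abs_of_nonneg ha0, abs_of_nonneg hb0]
    gcongr
  have h1 := hanti.sum_le_integral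
  simp only [zero_add] at h1
  refine h1.trans ?_
  rw [intervalIntegral.integral_of_le (by positivity)]
  refine (setIntegral_le_integral hint (.of_forall fun t => (Real.exp_pos _).le)).trans_eq ?_
  rw [hf, Measure.integral_comp_mul_left (fun t => Real.exp (-|t| ^ s)) δ, abs_of_pos
    (inv_pos.2 hδ), smul_eq_mul, div_eq_inv_mul]

theorem sum_Icc_exp_neg_rpow_le {s δ : ℝ} (hs : 0 < s) (hδ : 0 < δ) (M : ℕ) :
    ∑ z ∈ Finset.Icc (-(M : ℤ)) M, Real.exp (-(|δ * (z : ℝ)| ^ s)) ≤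
      1 + 2 * ((∫ t : ℝ, Real.exp (-|t| ^ s)) / δ) := by
  have h := sum_Icc_neg_natAbs (fun i => Real.exp (-(|δ * (i : ℝ)| ^ s))) M
  have h' : ∀ z : ℤ, |δ * ((z.natAbs : ℕ) : ℝ)| = |δ * (z : ℝ)| := by
    intro z; rw [abs_mul, abs_mul, Nat.cast_natAbs, Int.cast_abs, abs_abs]
  simp only [h'] at h
  rw [h]
  have := sum_range_exp_neg_rpow_le hs hδ M
  simp only [Nat.cast_zero, mul_zero, abs_zero, Real.zero_rpow hs.ne', neg_zero, Real.exp_zero]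
  linarith

/-- A weight `l ≥ 1` in the exponent suppresses all terms but the one at zero. -/
theorem sum_Icc_exp_neg_mul_rpow_le {s l : ℝ} (hs : 0 < s) (hl : 1 ≤ l) (M : ℕ) :
    ∑ z ∈ Finset.Icc (-(M : ℤ)) M, Real.exp (-(l * |(z : ℝ)| ^ s)) ≤
      1 + 2 * (∫ t : ℝ, Real.exp (-|t| ^ s)) * Real.exp (1 - l) := by
  have h := sum_Icc_neg_natAbs (fun i => Real.exp (-(l * |(i : ℝ)| ^ s))) M
  have h' : ∀ z : ℤ, |((z.natAbs : ℕ) : ℝ)| = |(z : ℝ)| := by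
    intro z; rw [Nat.cast_natAbs, Int.cast_abs, abs_abs]
  simp only [h'] at h
  rw [h]
  have h1 := sum_range_exp_neg_rpow_le hs one_pos M
  -- For `u ≥ 1` and `l ≥ 1` one has `l u ≥ u + (l - 1)`; here `u = (i + 1)^s`.
  have h2 : ∑ i ∈ Finset.range M, Real.exp (-(l * |((i + 1 : ℕ) : ℝ)| ^ s)) ≤
      ∑ i ∈ Finset.range M, Real.exp (1 - l) * Real.exp (-(|1 * ((i + 1 : ℕ) : ℝ)| ^ s)) := by
    refine Finset.sum_le_sum fun i _ => ?_
    rw [← Real.exp_add, one_mul]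
    refine Real.exp_le_exp.2 ?_
    have : 1 ≤ |((i + 1 : ℕ) : ℝ)| ^ s := by
      refine Real.one_le_rpow ?_ hs.le
      rw [Nat.abs_cast]; exact_mod_cast Nat.le_add_left 1 i
    nlinarith
  rw [← Finset.mul_sum] at h2
  rw [div_one] at h1
  have h3 := h2.trans (mul_le_mul_of_nonneg_left h1 (Real.exp_pos (1 - l)).le)
  simp only [Nat.cast_zero, abs_zero, Real.zero_rpow hs.ne', mul_zero, neg_zero, Real.exp_zero]
  linarith

/-- Exponential-moment bound for the number of points of `h ℤ^n` in the unit ball of `ℓ_s^n`. -/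
theorem card_lattice_points_le {s h μ : ℝ} (hμ : 0 ≤ μ) (n M : ℕ) :
    ((((Fintype.piFinset fun _ : Fin n => Finset.Icc (-(M : ℤ)) M).filter
      fun z => ∑ i, |h * (z i : ℝ)| ^ s ≤ 1).card : ℕ) : ℝ) ≤
      Real.exp μ * (∑ z ∈ Finset.Icc (-(M : ℤ)) M, Real.exp (-(μ * |h * (z : ℝ)| ^ s))) ^ n := by
  set S := Fintype.piFinset fun _ : Fin n => Finset.Icc (-(M : ℤ)) M
  have hprod : (∑ z ∈ Finset.Icc (-(M : ℤ)) M, Real.exp (-(μ * |h * (z : ℝ)| ^ s))) ^ n =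
      ∑ z ∈ S, ∏ i, Real.exp (-(μ * |h * (z i : ℝ)| ^ s)) := by
    simpa using Finset.prod_univ_sum (fun _ : Fin n => Finset.Icc (-(M : ℤ)) M)
      (fun _ z => Real.exp (-(μ * |h * (z : ℝ)| ^ s)))
  rw [hprod, Finset.mul_sum, Finset.cast_card]
  -- Each counted point has weight `exp (μ (1 - ∑ |h z i|^s)) ≥ 1`; the total weight over the whole
  -- box is a product over coordinates.
  refine le_trans (Finset.sum_le_sum fun z hz => ?_)
    (Finset.sum_le_sum_of_subset_of_nonneg (Finset.filter_subset _ S)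
      fun z _ _ => by positivity)
  rw [← Real.exp_sum, ← Real.exp_add, Finset.sum_neg_distrib, ← Finset.mul_sum]
  have := (Finset.mem_filter.1 hz).2
  exact Real.one_le_exp (by nlinarith)

/-- Covering the unit ball of `ℓ_p^n` by rounding to the points of `h ℤ^n` in it. -/
theorem entropyNumber_le_of_lattice {p q : ℝ≥0∞} (hp : 0 < p) (hq : 0 < q) {n k : ℕ} {h r : ℝ}
    (hh : 0 < h) (hr : 0 < r) (Z : Finset (Fin n → ℤ))
    (hZ : ∀ z : Fin n → ℤ, (∀ i, z i ∈ Finset.Icc (-(⌊h⁻¹⌋₊ : ℤ)) ⌊h⁻¹⌋₊) →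
      (fun i => h * (z i : ℝ)) ∈ lpBall p n 1 → z ∈ Z)
    (hcard : (Z.card : ℝ) ≤ 2 ^ (k - 1))
    (hball : ∀ x ∈ lpBall p n 1, (∀ i, |x i| ≤ h) → x ∈ lpBall q n r) :
    entropyNumber k (lpId p q n) ≤ r := by
  classical
  refine entropyNumber_lpId_le hq hr (Z.image fun z i => h * (z i : ℝ)) ?_ fun x hx => ?_
  · exact Finset.card_image_le.trans (by exact_mod_cast hcard)
  · choose z hz using fun i => exists_int_round_toward_zero (x i / h)
    have hxz : ∀ i, |x i - h * z i| = h * |x i / h - z i| := fun i => by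
      rw [← abs_of_pos hh, ← abs_mul, mul_sub, abs_of_pos hh, mul_div_cancel₀ _ hh.ne']
    have hxh : ∀ i, h * |x i / h| = |x i| := fun i => by
      rw [← abs_of_pos hh, ← abs_mul, abs_of_pos hh, mul_div_cancel₀ _ hh.ne']
    have hle : ∀ i, |h * (z i : ℝ)| ≤ |x i| := fun i => by
      rw [abs_mul, abs_of_pos hh, ← hxh i]
      exact mul_le_mul_of_nonneg_left (hz i).2.2 hh.le
    refine ⟨_, Finset.mem_image_of_mem _ (hZ z (fun i => ?_)
      (mem_lpBall_of_abs_le hp zero_le_one hx hle)), hball _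
        (mem_lpBall_of_abs_le hp zero_le_one hx fun i => ?_) fun i => ?_⟩
    · have hzi : ((z i).natAbs : ℝ) ≤ h⁻¹ := by
        rw [Nat.cast_natAbs, Int.cast_abs, ← mul_le_mul_iff_right₀ hh, mul_inv_cancel₀ hh.ne',
          ← abs_of_pos hh, ← abs_mul]
        exact (hle i).trans (abs_apply_le_of_mem_lpBall hp zero_le_one hx i)
      have := Nat.le_floor hzi
      rw [Finset.mem_Icc]; lia
    · simp only [Pi.sub_apply]
      rw [hxz, ← hxh i]
      exact mul_le_mul_of_nonneg_left (hz i).2.1 hh.le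
    · simp only [Pi.sub_apply]
      rw [hxz]
      exact mul_le_of_le_one_right hh.le (hz i).1

/-- The parameter `μ` is free, to be matched to `h`. The moment bound is required for every `M`,
since the series over `ℤ` converges and the box size `⌊h⁻¹⌋₊` plays no role. -/
theorem entropyNumber_le_of_exp_moment {p q : ℝ≥0∞} (hp : 0 < p) (hpt : p ≠ ⊤) (hq : 0 < q)
    {n k : ℕ} {h r μ : ℝ} (hh : 0 < h) (hr : 0 < r) (hμ : 0 ≤ μ)
    (hcard : ∀ M : ℕ, Real.exp μ * (∑ z ∈ Finset.Icc (-(M : ℤ)) M,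
      Real.exp (-(μ * |h * (z : ℝ)| ^ p.toReal))) ^ n ≤ 2 ^ (k - 1))
    (hball : ∀ x ∈ lpBall p n 1, (∀ i, |x i| ≤ h) → x ∈ lpBall q n r) :
    entropyNumber k (lpId p q n) ≤ r := by
  refine entropyNumber_le_of_lattice hp hq hh hr _ (fun z hz hzp => ?_)
    ((card_lattice_points_le (s := p.toReal) (h := h) hμ n ⌊h⁻¹⌋₊).trans (hcard _)) hball
  rw [mem_lpBall_iff_sum (ENNReal.toReal_pos hp.ne' hpt) zero_le_one, Real.one_rpow] at hzp
  exact Finset.mem_filter.2 ⟨Fintype.mem_piFinset.2 hz, hzp⟩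

/-! ### Upper bounds -/

/-- The upper bound for `2 ≤ k ≤ n`. -/
theorem exists_entropyNumber_le_logb {p q : ℝ≥0∞} (hp : 0 < p) (hpt : p ≠ ⊤) (hpq : p ≤ q) :
    ∃ C : ℝ, 0 < C ∧ ∀ n k : ℕ, 2 ≤ k → k ≤ n → entropyNumber k (lpId p q n) ≤
      C * (Real.logb 2 (1 + (n : ℝ) / (k : ℝ)) / (k : ℝ)) ^ (recip p - recip q) := by
  have hp' := ENNReal.toReal_pos hp.ne' hpt
  set s := p.toReal with hs
  set I := ∫ t : ℝ, Real.exp (-|t| ^ s) with hI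
  have hI0 : 0 < I := integral_exp_neg_abs_rpow_pos hp'
  -- `K` comes from the tail `2 I e^(1-l)`; `A` makes `K e^(-A) ≤ 1/10`; `c` makes `l m ≤ k/10`. The
  -- two exponents then add up to at most `k/5`.
  set K : ℝ := 2 * I * Real.exp 1 with hK
  have hK0 : 0 < K := by positivity
  set A : ℝ := 1 + 10 * K with hA
  have hA0 : 0 < A + 1 := by positivity
  set c : ℝ := (10 * (A + 1))⁻¹ with hc
  have hc0 : 0 < c := by positivity
  refine ⟨c⁻¹ ^ (recip p - recip q), by positivity, fun n k hk hkn => ?_⟩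
  have hk2 : (2 : ℝ) ≤ k := by exact_mod_cast hk
  have hk0 : (0 : ℝ) < k := by linarith
  have hkn' : (k : ℝ) ≤ n := by exact_mod_cast hkn
  have hn0 : (0 : ℝ) < n := by linarith
  set L := Real.logb 2 (1 + (n : ℝ) / (k : ℝ)) with hL
  have hnk : 1 ≤ (n : ℝ) / k := (one_le_div hk0).2 hkn'
  have hL1 : 1 ≤ L := by
    rw [hL, Real.le_logb_iff_rpow_le one_lt_two (by positivity)]
    norm_num; linarith
  have hlogL : Real.log (1 + (n : ℝ) / k) ≤ L := by
    rw [hL, Real.logb, le_div_iff₀ (Real.log_pos one_lt_two)]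
    exact mul_le_of_le_one_right (Real.log_nonneg (by linarith))
      (by linarith [Real.log_two_lt_d9])
  have hlog0 : 0 ≤ Real.log (1 + (n : ℝ) / k) := Real.log_nonneg (by linarith)
  set l : ℝ := A + Real.log (1 + (n : ℝ) / k) with hl
  have hl1 : 1 ≤ l := by linarith
  -- With `h = m^(-1/p)` and `μ = l m`, the weight `μ |h z|^p` becomes `l |z|^p`. The term
  -- `log(1+n/k)` in `l` compensates the `n` factors of the moment.
  set m : ℝ := c * k / L with hm
  have hm0 : 0 < m := by positivity
  have hball : ∀ x ∈ lpBall p n 1, (∀ i, |x i| ≤ m⁻¹ ^ s⁻¹) →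
      x ∈ lpBall q n (c⁻¹ ^ (recip p - recip q) * (L / k) ^ (recip p - recip q)) := by
    intro x hx hxh
    have h := mem_lpBall_interpolation hp hpt hpq (by positivity) hx hxh
    rw [← Real.rpow_mul (by positivity), ← mul_assoc, inv_mul_cancel₀ hp'.ne', one_mul] at h
    rw [← Real.mul_rpow (by positivity) (by positivity)]
    have : m⁻¹ = c⁻¹ * (L / k) := by rw [hm]; field_simp
    rwa [this] at h
  refine entropyNumber_le_of_exp_moment hp hpt (hp.trans_le hpq) (h := m⁻¹ ^ s⁻¹) (μ := l * m)
    (by positivity) (by positivity) (by positivity) (fun M => ?_) hball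
  have hterm : ∀ z : ℤ, l * m * |m⁻¹ ^ s⁻¹ * (z : ℝ)| ^ s = l * |(z : ℝ)| ^ s := by
    intro z
    rw [abs_mul, abs_of_pos (by positivity), Real.mul_rpow (by positivity) (abs_nonneg _),
      Real.rpow_inv_rpow (by positivity) hp'.ne']
    field_simp
  simp only [← hs, hterm]
  have hsum : ∑ z ∈ Finset.Icc (-(M : ℤ)) M, Real.exp (-(l * |(z : ℝ)| ^ s)) ≤
      Real.exp (K * Real.exp (-l)) := by
    refine (sum_Icc_exp_neg_mul_rpow_le hp' hl1 M).trans ?_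
    rw [← hI, sub_eq_add_neg, Real.exp_add, ← mul_assoc, ← hK, add_comm]
    exact Real.add_one_le_exp _
  have hexpl : n * (K * Real.exp (-l)) ≤ k / 10 := by
    have h1 : K * Real.exp (-A) ≤ 1 / 10 := by
      rw [Real.exp_neg, ← div_eq_mul_inv, div_le_iff₀ (Real.exp_pos _)]
      linarith [Real.add_one_le_exp A]
    have h2 : n * Real.exp (-Real.log (1 + (n : ℝ) / k)) ≤ k := by
      rw [Real.exp_neg, Real.exp_log (by positivity), ← div_eq_mul_inv,
        div_le_iff₀ (by positivity), mul_add, mul_div_cancel₀ _ hk0.ne']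
      linarith
    calc n * (K * Real.exp (-l))
        = (K * Real.exp (-A)) * (n * Real.exp (-Real.log (1 + (n : ℝ) / k))) := by
          rw [hl, neg_add, Real.exp_add]; ring
      _ ≤ 1 / 10 * k := by gcongr
      _ = k / 10 := by ring
  have hlm : l * m ≤ k / 10 := by
    have : l ≤ (A + 1) * L := by nlinarith
    calc l * m ≤ (A + 1) * L * m := by gcongr
      _ = k / 10 := by rw [hm, hc]; field_simp [hA0.ne']
  calc Real.exp (l * m) * (∑ z ∈ Finset.Icc (-(M : ℤ)) M, Real.exp (-(l * |(z : ℝ)| ^ s))) ^ n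
      ≤ Real.exp (l * m) * Real.exp (K * Real.exp (-l)) ^ n := by
        gcongr
    _ = Real.exp (l * m + n * (K * Real.exp (-l))) := by
        rw [← Real.exp_nat_mul, Real.exp_add]
    _ ≤ Real.exp (((k - 1 : ℕ) : ℝ) * Real.log 2) := by
        refine Real.exp_le_exp.2 ?_
        rw [Nat.cast_sub (by lia), Nat.cast_one]
        -- `k/5 ≤ (k-1) log 2` holds because `k ≥ 2`; it fails for `k = 1`.
        nlinarith [Real.log_two_gt_d9]
    _ = 2 ^ (k - 1) := by rw [Real.exp_nat_mul, Real.exp_log two_pos]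

theorem two_rpow_pow_eq {n k : ℕ} (hn : 1 ≤ n) (hk : 1 ≤ k) :
    ((2 : ℝ) ^ (-(((k : ℝ) - 1) / (n : ℝ)))) ^ n = (2 ^ (k - 1))⁻¹ := by
  have hn' : (n : ℝ) ≠ 0 := by positivity
  rw [← Real.rpow_natCast, ← Real.rpow_mul two_pos.le, neg_mul, div_mul_cancel₀ _ hn',
    Real.rpow_neg two_pos.le, ← Real.rpow_natCast 2 (k - 1), Nat.cast_sub hk, Nat.cast_one]

theorem exists_entropyNumber_top_le : ∃ C : ℝ, 0 < C ∧ ∀ n k : ℕ, 1 ≤ n → 1 ≤ k →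
    entropyNumber k (lpId ⊤ ⊤ n) ≤ C * (2 : ℝ) ^ (-(((k : ℝ) - 1) / (n : ℝ))) := by
  -- The `3` comes from `2 ⌊1/h⌋ + 1 ≤ 3/h` for `h ≤ 1`; for `h ≥ 1` the bound `e_k ≤ 1` suffices.
  refine ⟨3, by norm_num, fun n k hn hk => ?_⟩
  set h : ℝ := 3 * (2 : ℝ) ^ (-(((k : ℝ) - 1) / (n : ℝ))) with hh
  have hh0 : 0 < h := by positivity
  rcases le_total 1 h with h1 | h1
  · exact (entropyNumber_lpId_le_one ENNReal.zero_lt_top le_rfl n k).trans h1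
  refine entropyNumber_le_of_lattice ENNReal.zero_lt_top ENNReal.zero_lt_top hh0 hh0
    (Fintype.piFinset fun _ : Fin n => Finset.Icc (-(⌊h⁻¹⌋₊ : ℤ)) ⌊h⁻¹⌋₊)
    (fun z hz _ => Fintype.mem_piFinset.2 hz) ?_ fun x _ hx => (mem_lpBall_top hh0.le).2 hx
  have hcard : (Finset.Icc (-(⌊h⁻¹⌋₊ : ℤ)) ⌊h⁻¹⌋₊).card = 2 * ⌊h⁻¹⌋₊ + 1 := by
    rw [Int.card_Icc]; lia
  have hfl : (⌊h⁻¹⌋₊ : ℝ) ≤ h⁻¹ := Nat.floor_le (by positivity)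
  have hinv : 1 ≤ h⁻¹ := (one_le_inv₀ hh0).2 h1
  simp only [Fintype.card_piFinset, hcard, Finset.prod_const, Finset.card_univ, Fintype.card_fin]
  push_cast
  calc (2 * (⌊h⁻¹⌋₊ : ℝ) + 1) ^ n ≤ (3 * h⁻¹) ^ n := by gcongr; linarith
    _ = 2 ^ (k - 1) := by
      rw [hh, mul_inv, mul_inv_cancel_left₀ (by norm_num), inv_pow, two_rpow_pow_eq hn hk, inv_inv]

/-- The upper bound for `k ≥ n`. -/
theorem exists_entropyNumber_le_of_le {p q : ℝ≥0∞} (hp : 0 < p) (hpq : p ≤ q) :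
    ∃ C : ℝ, 0 < C ∧ ∀ n k : ℕ, 1 ≤ n → n ≤ k → entropyNumber k (lpId p q n) ≤
      C * ((2 : ℝ) ^ (-(((k : ℝ) - 1) / (n : ℝ))) * (n : ℝ) ^ (recip q - recip p)) := by
  have hq := hp.trans_le hpq
  rcases eq_or_ne p ⊤ with rfl | hpt
  · obtain rfl := top_le_iff.1 hpq
    obtain ⟨C, hC, h⟩ := exists_entropyNumber_top_le
    exact ⟨C, hC, fun n k hn hk => by simpa using h n k hn (hn.trans hk)⟩
  have hp' := ENNReal.toReal_pos hp.ne' hpt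
  obtain ⟨C₁, hC₁, hmid⟩ := exists_entropyNumber_le_logb hp hpt hpq
  set s := p.toReal with hs
  set I := ∫ t : ℝ, Real.exp (-|t| ^ s) with hI
  have hI0 : 0 < I := integral_exp_neg_abs_rpow_pos hp'
  set K : ℝ := Real.exp 1 * (1 + 2 * I) with hK
  have hK0 : 0 < K := by positivity
  refine ⟨K * max 1 C₁, by positivity, fun n k hn hk => ?_⟩
  have hn0 : (0 : ℝ) < n := by exact_mod_cast hn
  set T : ℝ := (2 : ℝ) ^ (-(((k : ℝ) - 1) / (n : ℝ))) with hT
  have hT0 : 0 < T := by positivity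
  -- If `K T ≤ 1`, round with mesh `K T n^(-1/p)` and take `μ = n`; `K` absorbs `e` from `exp μ` and
  -- `1 + 2I` from the sum. Otherwise `T` is bounded below, and `e_k ≤ e_n` is enough, with `e_n`
  -- bounded by the previous range, where `log₂(1 + n/n) = 1`.
  rcases le_total (K * T) 1 with h1 | h1
  · set δ := K * T with hδ
    have hδ0 : 0 < δ := by positivity
    have key : entropyNumber k (lpId p q n) ≤ δ * (n : ℝ) ^ (-recip p) * (n : ℝ) ^ recip q := by
      refine entropyNumber_le_of_exp_moment hp hpt hq (h := δ * (n : ℝ) ^ (-recip p))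
        (μ := n) (by positivity) (by positivity) (by positivity) (fun M => ?_)
        fun x _ hx => mem_lpBall_of_forall_abs_le hq (by positivity) hx
      have hterm : ∀ z : ℤ, n * |δ * (n : ℝ) ^ (-recip p) * (z : ℝ)| ^ s = |δ * (z : ℝ)| ^ s := by
        intro z
        rw [mul_right_comm, abs_mul, Real.mul_rpow (abs_nonneg _) (abs_nonneg _),
          abs_of_pos (Real.rpow_pos_of_pos hn0 _), ← Real.rpow_mul hn0.le, recip_eq_inv_toReal,
          neg_mul, inv_mul_cancel₀ hp'.ne', Real.rpow_neg_one]
        field_simp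
      simp only [← hs, hterm]
      have hsum := sum_Icc_exp_neg_rpow_le hp' hδ0 M
      rw [← hI] at hsum
      have hsum' : 1 + 2 * (I / δ) ≤ (1 + 2 * I) / δ := by
        rw [add_div, mul_div_assoc]
        gcongr
        exact (one_le_div hδ0).2 h1
      calc Real.exp n * (∑ z ∈ Finset.Icc (-(M : ℤ)) M, Real.exp (-(|δ * (z : ℝ)| ^ s))) ^ n
          ≤ Real.exp n * ((1 + 2 * I) / δ) ^ n := by
            gcongr
            exact hsum.trans hsum'
        _ = T⁻¹ ^ n := by
            rw [← mul_one (n : ℝ), Real.exp_nat_mul, ← mul_pow, hδ]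
            congr 1
            rw [hK]; field_simp
        _ = 2 ^ (k - 1) := by rw [inv_pow, hT, two_rpow_pow_eq hn (hn.trans hk), inv_inv]
    refine key.trans ?_
    rw [hδ, mul_assoc (K * T), ← Real.rpow_add hn0, neg_add_eq_sub]
    calc K * T * (n : ℝ) ^ (recip q - recip p)
        ≤ max 1 C₁ * (K * T * (n : ℝ) ^ (recip q - recip p)) :=
          le_mul_of_one_le_left (by positivity) (le_max_left _ _)
      _ = _ := by ring
  · have hn1 : entropyNumber k (lpId p q n) ≤ max 1 C₁ * (n : ℝ) ^ (recip q - recip p) := by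
      rcases Nat.lt_or_ge n 2 with h2 | h2
      · obtain rfl : n = 1 := by lia
        refine (entropyNumber_lpId_le_one hp hpq 1 k).trans ?_
        simp
      · refine (entropyNumber_lpId_antitone hp hq hk).trans ((hmid n n h2 le_rfl).trans ?_)
        rw [div_self hn0.ne', one_add_one_eq_two, Real.logb_self_eq_one one_lt_two, one_div,
          Real.inv_rpow hn0.le, ← Real.rpow_neg hn0.le, neg_sub]
        gcongr
        exact le_max_right _ _
    refine hn1.trans ?_
    calc max 1 C₁ * (n : ℝ) ^ (recip q - recip p)
        ≤ (K * T) * (max 1 C₁ * (n : ℝ) ^ (recip q - recip p)) :=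
          le_mul_of_one_le_left (by positivity) h1
      _ = _ := by ring

/-- The upper bound for `k ≤ n`. -/
theorem exists_entropyNumber_le_logb_of_le {p q : ℝ≥0∞} (hp : 0 < p) (hpq : p ≤ q) :
    ∃ C : ℝ, 0 < C ∧ ∀ n k : ℕ, 1 ≤ k → k ≤ n →
      entropyNumber k (lpId p q n) ≤
        C * (Real.logb 2 (1 + (n : ℝ) / (k : ℝ)) / (k : ℝ)) ^ (recip p - recip q) := by
  rcases eq_or_ne p ⊤ with rfl | hpt
  · obtain rfl := top_le_iff.1 hpq
    exact ⟨1, one_pos, fun n k _ _ => by simpa using entropyNumber_lpId_le_one hp le_rfl n k⟩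
  obtain ⟨C, hC, h⟩ := exists_entropyNumber_le_logb hp hpt hpq
  refine ⟨max 1 C, by positivity, fun n k hk hkn => ?_⟩
  have hk0 : (0 : ℝ) < k := by exact_mod_cast hk
  have hkn' : (1 : ℝ) ≤ (n : ℝ) / k := (one_le_div hk0).2 (by exact_mod_cast hkn)
  have hL : 1 ≤ Real.logb 2 (1 + (n : ℝ) / (k : ℝ)) := by
    rw [Real.le_logb_iff_rpow_le one_lt_two (by linarith)]
    norm_num; linarith
  rcases Nat.lt_or_ge k 2 with h2 | h2
  · obtain rfl : k = 1 := by lia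
    refine (entropyNumber_lpId_le_one hp hpq n 1).trans ?_
    refine one_le_mul_of_one_le_of_one_le (le_max_left _ _) (Real.one_le_rpow ?_
      (sub_nonneg.2 (recip_le_recip hp hpq)))
    simpa using hL
  · refine (h n k h2 hkn).trans ?_
    gcongr
    exact le_max_right _ _

/-- For `k ≤ n` the factor `2^(-(k-1)/n)` is at least `1/2`, so `e_k ≤ 1` already gives the bound
with constant `2`. -/
theorem exists_entropyNumber_self_le {q : ℝ≥0∞} (hq : 0 < q) :
    ∃ C : ℝ, 0 < C ∧ ∀ n k : ℕ, 1 ≤ n → 1 ≤ k →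
      entropyNumber k (lpId q q n) ≤ C * (2 : ℝ) ^ (-(((k : ℝ) - 1) / (n : ℝ))) := by
  obtain ⟨C, hC, h⟩ := exists_entropyNumber_le_of_le hq le_rfl
  refine ⟨max 2 C, by positivity, fun n k hn hk => ?_⟩
  have hn0 : (0 : ℝ) < n := by exact_mod_cast hn
  rcases le_total n k with hnk | hnk
  · refine (h n k hn hnk).trans ?_
    rw [sub_self, Real.rpow_zero, mul_one]
    gcongr
    exact le_max_right _ _
  · refine (entropyNumber_lpId_le_one hq le_rfl n k).trans ?_
    have hnk' : (k : ℝ) ≤ n := by exact_mod_cast hnk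
    have hT : (2 : ℝ)⁻¹ ≤ (2 : ℝ) ^ (-(((k : ℝ) - 1) / (n : ℝ))) := by
      rw [← Real.rpow_neg_one]
      refine Real.rpow_le_rpow_of_exponent_le one_le_two (neg_le_neg ?_)
      rw [div_le_one hn0]; linarith
    calc (1 : ℝ) = 2 * 2⁻¹ := by norm_num
      _ ≤ _ := by gcongr; exact le_max_left _ _

/-! ### Lower bounds by packing -/

/-- The vector with entries `v` on a finite set `S` and `0` elsewhere. -/
def flatVector {n : ℕ} (S : Finset (Fin n)) (v : ℝ) : Fin n → ℝ := fun i => if i ∈ S then v else 0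

theorem flatVector_mem_lpBall {p : ℝ≥0∞} (hp : 0 < p) {n : ℕ} {S : Finset (Fin n)}
    (hS : S.Nonempty) : flatVector S ((S.card : ℝ) ^ (-recip p)) ∈ lpBall p n 1 := by
  rcases eq_or_ne p ⊤ with rfl | hpt
  · rw [mem_lpBall_top zero_le_one, recip_top, neg_zero, Real.rpow_zero]
    intro i
    unfold flatVector
    split_ifs <;> simp
  · have hp' := ENNReal.toReal_pos hp.ne' hpt
    have hc : (0 : ℝ) < S.card := by exact_mod_cast hS.card_pos
    rw [mem_lpBall_iff_sum hp' zero_le_one, Real.one_rpow]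
    have : ∀ i, |flatVector S ((S.card : ℝ) ^ (-recip p)) i| ^ p.toReal =
        if i ∈ S then (S.card : ℝ)⁻¹ else 0 := by
      intro i
      unfold flatVector
      split_ifs
      · rw [abs_of_pos (by positivity), ← Real.rpow_mul hc.le, recip_eq_inv_toReal, neg_mul,
          inv_mul_cancel₀ hp'.ne', Real.rpow_neg_one]
      · rw [abs_zero, Real.zero_rpow hp'.ne']
    simp only [this, Finset.sum_ite_mem, Finset.univ_inter, Finset.sum_const, nsmul_eq_mul]
    rw [mul_inv_cancel₀ hc.ne']

/-- A vector with many large entries has large norm. -/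
theorem mul_card_rpow_le_of_mem_lpBall {q : ℝ≥0∞} (hq : 0 < q) {n : ℕ} {r v : ℝ} (hr : 0 ≤ r)
    (hv : 0 ≤ v) {x : Fin n → ℝ} (hx : x ∈ lpBall q n r) {F : Finset (Fin n)} (hF : F.Nonempty)
    (hFx : ∀ i ∈ F, v ≤ |x i|) : v * (F.card : ℝ) ^ recip q ≤ r := by
  rcases eq_or_ne q ⊤ with rfl | hqt
  · obtain ⟨i, hi⟩ := hF
    simpa [recip_top] using (hFx i hi).trans ((mem_lpBall_top hr).1 hx i)
  · have hq' := ENNReal.toReal_pos hq.ne' hqt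
    rw [mem_lpBall_iff_sum hq' hr] at hx
    rw [← Real.rpow_le_rpow_iff (by positivity) hr hq', Real.mul_rpow hv (by positivity),
      recip_eq_inv_toReal, Real.rpow_inv_rpow (by positivity) hq'.ne']
    calc v ^ q.toReal * F.card = ∑ _i ∈ F, v ^ q.toReal := by simp [mul_comm]
      _ ≤ ∑ i ∈ F, |x i| ^ q.toReal :=
          Finset.sum_le_sum fun i hi => Real.rpow_le_rpow hv (hFx i hi) hq'.le
      _ ≤ ∑ i, |x i| ^ q.toReal := Finset.sum_le_sum_of_subset_of_nonneg (Finset.subset_univ _)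
          fun i _ _ => by positivity
      _ ≤ _ := hx

/-- If two flat vectors with supports `S`, `T` lie in one ball, then `S \ T` is small compared with
the radius. -/
theorem le_of_flatVector_mem {q : ℝ≥0∞} (hq : 0 < q) {n : ℕ} {r v : ℝ} (hr : 0 ≤ r)
    (hv : 0 ≤ v) {y : Fin n → ℝ} {S T : Finset (Fin n)} (hST : (S \ T).Nonempty)
    (hS : flatVector S v - y ∈ lpBall q n r) (hT : flatVector T v - y ∈ lpBall q n r) :
    v / 2 * (((S \ T).card : ℝ) / 2) ^ recip q ≤ r := by
  classical
  have main : ∀ x ∈ lpBall q n r, ∀ F : Finset (Fin n), (S \ T).card ≤ 2 * F.card →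
      (∀ i ∈ F, v / 2 ≤ |x i|) → v / 2 * (((S \ T).card : ℝ) / 2) ^ recip q ≤ r := by
    intro x hx F hF hFx
    have hF0 : F.Nonempty := by
      rw [← Finset.card_pos]
      have := hST.card_pos
      lia
    refine le_trans ?_ (mul_card_rpow_le_of_mem_lpBall hq hr (by positivity) hx hF0 hFx)
    have : ((S \ T).card : ℝ) ≤ 2 * F.card := by exact_mod_cast hF
    gcongr
    · exact recip_nonneg q
    · linarith
  -- On `S \ T` the two flat vectors are `v` and `0`, so at each coordinate `y` is at least `v/2`
  -- away from one of them. One of the two is far on at least half of `S \ T`, which replaces the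
  -- quasi-triangle inequality.
  set F := (S \ T).filter fun i => v / 2 ≤ |(flatVector S v - y) i|
  set G := (S \ T).filter fun i => ¬ v / 2 ≤ |(flatVector S v - y) i|
  have hcard : F.card + G.card = (S \ T).card := Finset.card_filter_add_card_filter_not _
  rcases le_total G.card F.card with h | h
  · exact main _ hS F (by lia) fun i hi => (Finset.mem_filter.1 hi).2
  · refine main _ hT G (by lia) fun i hi => ?_
    obtain ⟨hiST, hi2⟩ := Finset.mem_filter.1 hi
    obtain ⟨hiS, hiT⟩ := Finset.mem_sdiff.1 hiST
    simp only [Pi.sub_apply, flatVector, hiS, hiT, if_true, if_false, not_le] at hi2 ⊢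
    rw [abs_lt] at hi2
    rw [zero_sub, abs_neg]
    exact le_trans (by linarith) (le_abs_self _)

/-- The lower bound for `k ≤ log₂ n`. -/
theorem half_le_entropyNumber {p q : ℝ≥0∞} (hp : 0 < p) (hq : 0 < q) {n k : ℕ} (hk : 1 ≤ k)
    (hn : 2 ^ k ≤ n) : 1 / 2 * (1 / 2 : ℝ) ^ recip q ≤ entropyNumber k (lpId p q n) := by
  refine le_entropyNumber_lpId hp hq fun r hr y hy => ?_
  have hmem : ∀ i : Fin n, flatVector {i} 1 ∈ lpBall p n 1 := fun i => by
    simpa using flatVector_mem_lpBall hp (Finset.singleton_nonempty i)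
  choose b hb using fun i => hy _ (hmem i)
  have hlt : Fintype.card (Fin (2 ^ (k - 1))) < Fintype.card (Fin n) := by
    simpa using (Nat.pow_lt_pow_right one_lt_two (by lia)).trans_le hn
  obtain ⟨i, j, hij, hbij⟩ := Fintype.exists_ne_map_eq_of_card_lt b hlt
  have hsd : ({i} : Finset (Fin n)) \ {j} = {i} := by simpa using hij
  have h := le_of_flatVector_mem hq hr.le zero_le_one (S := {i}) (T := {j})
    (by rw [hsd]; exact Finset.singleton_nonempty i) (hb i) (hbij ▸ hb j)
  simpa [hsd] using h

/-- The number of functions that agree with `g` on at least half of the points. -/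
theorem card_hamming_ball_le {m s : ℕ} (g : Fin m → Fin s) :
    (((Finset.univ.filter fun f : Fin m → Fin s =>
      2 * (Finset.univ.filter fun j => f j ≠ g j).card ≤ m).card : ℕ) : ℝ) ≤
      (2 * √(s : ℝ)) ^ m := by
  rcases Nat.eq_zero_or_pos m with rfl | hm
  · simp
  have hs : 1 ≤ s := by have := (g ⟨0, hm⟩).2; lia
  have hs1 : (1 : ℝ) ≤ s := by exact_mod_cast hs
  set σ := √(s : ℝ) with hσ
  have hσ1 : 1 ≤ σ := Real.one_le_sqrt.2 hs1
  have hσ0 : 0 < σ := by linarith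
  have hσσ : σ * σ = s := Real.mul_self_sqrt (by linarith)
  -- Chernoff weights: `σ = √s` for an agreement, `σ⁻¹` for a disagreement. The product is at least
  -- `1` when agreements are no fewer than disagreements, and each coordinate contributes at most `σ
  -- + s/σ = 2σ`.
  have hsum : ∑ f : Fin m → Fin s, ∏ j, (if f j = g j then σ else σ⁻¹) ≤ (2 * σ) ^ m := by
    have h := Finset.prod_univ_sum (fun _ : Fin m => (Finset.univ : Finset (Fin s)))
      (fun j a => if a = g j then σ else σ⁻¹)
    rw [Fintype.piFinset_univ] at h
    rw [← h]
    calc ∏ j, ∑ a, (if a = g j then σ else σ⁻¹) ≤ ∏ _j : Fin m, (2 * σ) := by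
          refine Finset.prod_le_prod (fun j _ => Finset.sum_nonneg fun a _ => by positivity)
            fun j _ => ?_
          calc ∑ a, (if a = g j then σ else σ⁻¹) ≤ ∑ a, ((if a = g j then σ else 0) + σ⁻¹) := by
                refine Finset.sum_le_sum fun a _ => ?_
                split_ifs
                · linarith [inv_pos.2 hσ0]
                · simp
            _ = 2 * σ := by
                rw [Finset.sum_add_distrib, Finset.sum_ite_eq' Finset.univ (g j)]
                simp only [Finset.mem_univ, if_true, Finset.sum_const, Finset.card_univ,
                  Fintype.card_fin, nsmul_eq_mul]
                rw [← hσσ]; field_simp; norm_num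
      _ = _ := by simp
  refine le_trans ?_ hsum
  rw [Finset.cast_card]
  refine le_trans (Finset.sum_le_sum fun f hf => ?_)
    (Finset.sum_le_sum_of_subset_of_nonneg (Finset.subset_univ _)
      fun f _ _ => Finset.prod_nonneg fun j _ => by positivity)
  have hf2 := (Finset.mem_filter.1 hf).2
  rw [Finset.prod_ite, Finset.prod_const, Finset.prod_const, inv_pow, ← div_eq_mul_inv,
    one_le_div (by positivity)]
  refine pow_le_pow_right₀ hσ1 ?_
  have := Finset.card_filter_add_card_filter_not (s := (Finset.univ : Finset (Fin m)))
    (fun j => f j = g j)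
  simp only [Finset.card_univ, Fintype.card_fin] at this
  simp only [ne_eq] at hf2 ⊢
  lia

/-- A lower bound from a packing by flat vectors supported on transversals of `m` blocks of
length `s`. -/
theorem le_entropyNumber_of_blocks {p q : ℝ≥0∞} (hp : 0 < p) (hq : 0 < q) {n k m s : ℕ}
    (hm : 1 ≤ m) (hms : m * s ≤ n)
    (hcount : (2 : ℝ) ^ (k - 1) * (2 * √(s : ℝ)) ^ m < (s : ℝ) ^ m) :
    (m : ℝ) ^ (-recip p) / 2 * ((m : ℝ) / 4) ^ recip q ≤ entropyNumber k (lpId p q n) := by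
  classical
  refine le_entropyNumber_lpId hp hq fun r hr y hy => ?_
  let e : Fin m × Fin s → Fin n := fun a => Fin.castLE hms (finProdFinEquiv a)
  have he : Function.Injective e := (Fin.castLE_injective hms).comp finProdFinEquiv.injective
  let S : (Fin m → Fin s) → Finset (Fin n) := fun f => Finset.univ.image fun j => e (j, f j)
  have hSinj : ∀ f : Fin m → Fin s, Function.Injective fun j => e (j, f j) := fun f i j hij =>
    (Prod.ext_iff.1 (he hij)).1
  have hScard : ∀ f, (S f).card = m := fun f => by
    simp [S, Finset.card_image_of_injective _ (hSinj f)]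
  have hSne : ∀ f, (S f).Nonempty := fun f => by
    rw [← Finset.card_pos, hScard]; lia
  have hdiff : ∀ f g : Fin m → Fin s,
      (Finset.univ.filter fun j => f j ≠ g j).card ≤ (S f \ S g).card := fun f g => by
    rw [← Finset.card_image_of_injective _ (hSinj f)]
    refine Finset.card_le_card fun i hi => ?_
    obtain ⟨j, hj, rfl⟩ := Finset.mem_image.1 hi
    have hj := (Finset.mem_filter.1 hj).2
    refine Finset.mem_sdiff.2 ⟨Finset.mem_image_of_mem _ (Finset.mem_univ j), fun hg => ?_⟩
    obtain ⟨j', -, hj'⟩ := Finset.mem_image.1 hg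
    have h := Prod.ext_iff.1 (he hj')
    obtain rfl : j' = j := h.1
    exact hj h.2.symm
  choose b hb using fun f => hy _ (flatVector_mem_lpBall hp (hSne f))
  simp only [hScard] at hb
  by_contra! hlt
  -- Transversals sharing a ball agree on at least half of the blocks: otherwise `S f \ S g` has
  -- more than `m/2` points, and the flat vectors force `r` above the claimed bound.
  have hclose : ∀ f g, b f = b g → 2 * (Finset.univ.filter fun j => f j ≠ g j).card ≤ m := by
    intro f g hfg
    by_contra! hfar
    have hfar' : m < 2 * (S f \ S g).card := hfar.trans_le (by have := hdiff f g; lia)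
    have hne : (S f \ S g).Nonempty := by rw [← Finset.card_pos]; lia
    have h := le_of_flatVector_mem hq hr.le (by positivity) hne (hb f) (hfg ▸ hb g)
    refine absurd (le_trans ?_ h) (not_le.2 hlt)
    have : (m : ℝ) ≤ 2 * (S f \ S g).card := by exact_mod_cast hfar'.le
    exact mul_le_mul_of_nonneg_left
      (Real.rpow_le_rpow (by positivity) (by linarith) (recip_nonneg q)) (by positivity)
  -- Each ball thus captures at most a Hamming ball of transversals, so `2^(k-1)` balls cannot hold
  -- all `s^m` of them.
  have hfib : ∀ c, (((Finset.univ.filter fun f => b f = c).card : ℕ) : ℝ) ≤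
      (2 * √(s : ℝ)) ^ m := by
    intro c
    rcases (Finset.univ.filter fun f => b f = c).eq_empty_or_nonempty with h0 | ⟨g, hg⟩
    · rw [h0, Finset.card_empty, Nat.cast_zero]; positivity
    · refine le_trans ?_ (card_hamming_ball_le g)
      refine Nat.cast_le.2 (Finset.card_le_card fun f hf => ?_)
      rw [Finset.mem_filter] at hf hg ⊢
      exact ⟨Finset.mem_univ _, hclose f g (hf.2.trans hg.2.symm)⟩
  have htot : ((s : ℝ)) ^ m = ∑ c, (((Finset.univ.filter fun f => b f = c).card : ℕ) : ℝ) := by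
    have := Finset.card_eq_sum_card_fiberwise (f := b) (s := Finset.univ) (t := Finset.univ)
      (fun f _ => Finset.mem_coe.2 (Finset.mem_univ _))
    rw [← Nat.cast_sum, ← this]
    simp
  refine absurd hcount (not_lt.2 ?_)
  rw [htot]
  refine (Finset.sum_le_sum fun c _ => hfib c).trans_eq ?_
  simp

/-- The lower bound for `log₂ n ≤ k ≤ n / 256`. -/
theorem exists_logb_le_entropyNumber_of_sparse {p q : ℝ≥0∞} (hp : 0 < p) (hpq : p ≤ q) :
    ∃ c : ℝ, 0 < c ∧ ∀ n k : ℕ, 1 ≤ k → Real.logb 2 n ≤ k → 256 * k ≤ n →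
      c * (Real.logb 2 (1 + (n : ℝ) / (k : ℝ)) / (k : ℝ)) ^ (recip p - recip q)
        ≤ entropyNumber k (lpId p q n) := by
  have ha : 0 ≤ recip p - recip q := sub_nonneg.2 (recip_le_recip hp hpq)
  set a := recip p - recip q with ha_def
  refine ⟨1 / 2 * (1 / 4 : ℝ) ^ recip q * (1 / 10 : ℝ) ^ a, by positivity,
    fun n k hk hlog hkn => ?_⟩
  have hk1 : (1 : ℝ) ≤ k := by exact_mod_cast hk
  have hk0 : (0 : ℝ) < k := by linarith
  have hkn' : 256 * (k : ℝ) ≤ n := by exact_mod_cast hkn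
  have hn1 : (1 : ℝ) ≤ n := by linarith
  set t : ℝ := (n : ℝ) / k with ht
  have ht256 : 256 ≤ t := (le_div_iff₀ hk0).2 hkn'
  set L := Real.logb 2 (1 + t) with hL
  have h2L : (2 : ℝ) ^ L = 1 + t := Real.rpow_logb two_pos (by norm_num) (by linarith)
  have hL8 : 8 ≤ L := by
    rw [hL, Real.le_logb_iff_rpow_le one_lt_two (by linarith)]
    norm_num; linarith
  -- Here `log₂ n ≤ k` enters: it makes the rounding up in `m` cost at most `2k/L`, whence `m ≤ 10
  -- k/L`.
  have hL2k : L ≤ 2 * k := by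
    have h1 : L ≤ Real.logb 2 (2 * n) := by
      refine Real.logb_le_logb_of_le one_lt_two (by linarith) ?_
      have : t ≤ n := div_le_self (by linarith) hk1
      linarith
    rw [Real.logb_mul two_ne_zero (by linarith), Real.logb_self_eq_one one_lt_two] at h1
    linarith
  -- The `8` gives `2^k ≤ 2^(L m / 8)`; together with `√s ≥ 2 · 2^(L/8)` this yields the count.
  set m : ℕ := ⌈8 * k / L⌉₊ with hm
  have hm_ge : 8 * k / L ≤ m := Nat.le_ceil _
  have hm_pos : (0 : ℝ) < m := lt_of_lt_of_le (by positivity) hm_ge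
  have hm1 : 1 ≤ m := by exact_mod_cast hm_pos
  have hm_le : (m : ℝ) ≤ 10 * (k / L) := by
    have h1 : (m : ℝ) < 8 * k / L + 1 := Nat.ceil_lt_add_one (by positivity)
    have h2 : 1 ≤ 2 * (k / L) := by
      rw [← mul_div_assoc]; exact (one_le_div (by linarith)).2 hL2k
    rw [mul_div_assoc] at h1
    linarith
  set s : ℕ := n / m with hs
  have hs_ge : t / 2 ≤ s := by
    have h1 : (n : ℝ) < m * (s + 1) := by
      have := Nat.lt_mul_div_succ n hm1
      exact_mod_cast this
    have h2 : (m : ℝ) * (s + 1) ≤ 10 * (k / L) * (s + 1) := by gcongr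
    have h3 : 10 * (k / L) * ((s : ℝ) + 1) ≤ 10 * (k / 8) * (s + 1) := by gcongr
    have h4 : (n : ℝ) = t * k := by rw [ht, div_mul_cancel₀ _ hk0.ne']
    have h5 : t * k < (10 / 8 * (s + 1)) * k := by linarith
    have h6 := lt_of_mul_lt_mul_right h5 hk0.le
    linarith
  have hsqrt : 2 * (2 : ℝ) ^ (L / 8) ≤ √(s : ℝ) := by
    refine Real.le_sqrt_of_sq_le ?_
    set w : ℝ := (2 : ℝ) ^ (L / 4) with hw
    have hw4 : w ^ 4 = 1 + t := by
      rw [hw, ← Real.rpow_natCast, ← Real.rpow_mul two_pos.le, ← h2L]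
      congr 1; push_cast; ring
    have hwge : 4 ≤ w := by
      calc (4 : ℝ) = (2 : ℝ) ^ (2 : ℝ) := by norm_num
        _ ≤ w := Real.rpow_le_rpow_of_exponent_le one_le_two (by linarith)
    have hsq : (2 * (2 : ℝ) ^ (L / 8)) ^ 2 = 4 * w := by
      rw [mul_pow, ← Real.rpow_natCast ((2 : ℝ) ^ (L / 8)), ← Real.rpow_mul two_pos.le, hw]
      norm_num
      congr 1; ring
    have hw3 : 64 ≤ w ^ 3 := by
      calc (64 : ℝ) = 4 ^ 3 := by norm_num
        _ ≤ w ^ 3 := by gcongr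
    rw [hsq]
    nlinarith
  have hcount : (2 : ℝ) ^ (k - 1) * (2 * √(s : ℝ)) ^ m < (s : ℝ) ^ m := by
    have hs0 : (0 : ℝ) < s := by linarith
    have hσ0 : 0 < √(s : ℝ) ^ m := by positivity
    have h1 : (2 : ℝ) ^ k * 2 ^ m ≤ √(s : ℝ) ^ m := by
      calc (2 : ℝ) ^ k * 2 ^ m ≤ ((2 : ℝ) ^ (L / 8)) ^ m * 2 ^ m := by
            gcongr
            rw [← Real.rpow_natCast, ← Real.rpow_natCast ((2 : ℝ) ^ (L / 8)),
              ← Real.rpow_mul two_pos.le]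
            refine Real.rpow_le_rpow_of_exponent_le one_le_two ?_
            rw [div_le_iff₀ (by linarith)] at hm_ge
            linarith
        _ = (2 * (2 : ℝ) ^ (L / 8)) ^ m := by rw [← mul_pow, mul_comm]
        _ ≤ _ := by gcongr
    have h2 : (2 : ℝ) ^ (k - 1) < 2 ^ k := pow_lt_pow_right₀ one_lt_two (by lia)
    calc (2 : ℝ) ^ (k - 1) * (2 * √(s : ℝ)) ^ m = 2 ^ (k - 1) * 2 ^ m * √(s : ℝ) ^ m := by
          rw [mul_pow, mul_assoc]
      _ < 2 ^ k * 2 ^ m * √(s : ℝ) ^ m := by gcongr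
      _ ≤ √(s : ℝ) ^ m * √(s : ℝ) ^ m := by gcongr
      _ = (s : ℝ) ^ m := by rw [← mul_pow, Real.mul_self_sqrt hs0.le]
  refine le_trans ?_ (le_entropyNumber_of_blocks hp (hp.trans_le hpq) hm1
    (Nat.mul_div_le n m) hcount)
  have hfin : (1 / 10 : ℝ) ^ a * (L / k) ^ a ≤ (m : ℝ) ^ (-a) := by
    rw [← Real.mul_rpow (by norm_num) (by positivity), Real.rpow_neg hm_pos.le,
      ← Real.inv_rpow hm_pos.le]
    refine Real.rpow_le_rpow (by positivity) ?_ ha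
    rw [le_inv_comm₀ (by positivity) hm_pos]
    refine hm_le.trans_eq ?_
    field_simp
  calc 1 / 2 * (1 / 4 : ℝ) ^ recip q * (1 / 10 : ℝ) ^ a * (L / k) ^ a
      = 1 / 2 * (1 / 4 : ℝ) ^ recip q * ((1 / 10 : ℝ) ^ a * (L / k) ^ a) := by ring
    _ ≤ 1 / 2 * (1 / 4 : ℝ) ^ recip q * (m : ℝ) ^ (-a) := by gcongr
    _ = (m : ℝ) ^ (-recip p) / 2 * ((m : ℝ) / 4) ^ recip q := by
        rw [ha_def, neg_sub, sub_eq_add_neg, Real.rpow_add hm_pos, div_eq_mul_one_div (m : ℝ) 4,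
          Real.mul_rpow hm_pos.le (by norm_num)]
        ring

/-- The lower bound for `log₂ n ≤ k ≤ n`. -/
theorem exists_logb_le_entropyNumber {p q : ℝ≥0∞} (hp : 0 < p) (hpq : p ≤ q) :
    ∃ c : ℝ, 0 < c ∧ ∀ n k : ℕ, 1 ≤ k → Real.logb 2 n ≤ k → k ≤ n →
      c * (Real.logb 2 (1 + (n : ℝ) / (k : ℝ)) / (k : ℝ)) ^ (recip p - recip q)
        ≤ entropyNumber k (lpId p q n) := by
  have ha : 0 ≤ recip p - recip q := sub_nonneg.2 (recip_le_recip hp hpq)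
  obtain ⟨c₁, hc₁, h₁⟩ := exists_logb_le_entropyNumber_of_sparse hp hpq
  obtain ⟨c₂, hc₂, h₂⟩ := exists_volume_le_entropyNumber hp (hp.trans_le hpq)
  set a := recip p - recip q with ha_def
  -- For `n < 256 k` the volume bound is used: `L ≤ 9`, and `2304 = 9 · 256` gives `L/(2304 k) ≤
  -- 1/n`. The factor `1/2` bounds `2^(-(k-1)/n)` from below.
  refine ⟨min c₁ (c₂ / 2 * (1 / 2304 : ℝ) ^ a), by positivity, fun n k hk hlog hkn => ?_⟩
  have hk0 : (0 : ℝ) < k := by exact_mod_cast hk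
  have hkn' : (k : ℝ) ≤ n := by exact_mod_cast hkn
  have hn0 : (0 : ℝ) < n := by linarith
  set L := Real.logb 2 (1 + (n : ℝ) / k) with hL
  have hL0 : 0 ≤ L := Real.logb_nonneg one_lt_two (by linarith [div_pos hn0 hk0])
  rcases le_or_gt (256 * k) n with h | h
  · exact le_trans (by gcongr; exact min_le_left _ _) (h₁ n k hk hlog h)
  have h' : (n : ℝ) < 256 * k := by exact_mod_cast h
  have hL9 : L ≤ 9 := by
    rw [hL, Real.logb_le_iff_le_rpow one_lt_two (by positivity)]
    have : (n : ℝ) / k < 256 := (div_lt_iff₀ hk0).2 h'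
    norm_num; linarith
  refine le_trans ?_ (h₂ n k (hk.trans hkn) hk)
  have hT : (1 / 2 : ℝ) ≤ (2 : ℝ) ^ (-(((k : ℝ) - 1) / (n : ℝ))) := by
    rw [one_div, ← Real.rpow_neg_one]
    refine Real.rpow_le_rpow_of_exponent_le one_le_two (neg_le_neg ?_)
    rw [div_le_one hn0]; linarith
  have hbase : (1 / 2304 : ℝ) ^ a * (L / k) ^ a ≤ (n : ℝ) ^ (recip q - recip p) := by
    rw [← neg_sub (recip p), ← ha_def, ← Real.mul_rpow (by norm_num) (by positivity),
      Real.rpow_neg hn0.le, ← Real.inv_rpow hn0.le]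
    refine Real.rpow_le_rpow (by positivity) ?_ ha
    rw [← one_div (n : ℝ), div_mul_div_comm, div_le_div_iff₀ (by positivity) hn0]
    nlinarith
  calc min c₁ (c₂ / 2 * (1 / 2304 : ℝ) ^ a) * (L / k) ^ a
      ≤ c₂ / 2 * (1 / 2304 : ℝ) ^ a * (L / k) ^ a := by gcongr; exact min_le_right _ _
    _ = c₂ * (1 / 2 * ((1 / 2304 : ℝ) ^ a * (L / k) ^ a)) := by ring
    _ ≤ c₂ * ((2 : ℝ) ^ (-(((k : ℝ) - 1) / (n : ℝ))) * (n : ℝ) ^ (recip q - recip p)) := by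
        gcongr

/-! ### Assembly of the estimates -/

theorem theorem1p2 (p q : ℝ≥0∞) (hp : 0 < p) (hq : 0 < q) :
    (p ≤ q → ∃ c C : ℝ, 0 < c ∧ 0 < C ∧ ∀ n k : ℕ, 1 ≤ n → 1 ≤ k →
      ((k : ℝ) ≤ Real.logb 2 n →
        c * 1 ≤ entropyNumber k (lpId p q n) ∧ entropyNumber k (lpId p q n) ≤ C * 1) ∧
      (Real.logb 2 n ≤ (k : ℝ) → k ≤ n →
        c * (Real.logb 2 (1 + (n : ℝ) / (k : ℝ)) / (k : ℝ)) ^ (recip p - recip q)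
            ≤ entropyNumber k (lpId p q n) ∧
        entropyNumber k (lpId p q n)
            ≤ C * (Real.logb 2 (1 + (n : ℝ) / (k : ℝ)) / (k : ℝ)) ^ (recip p - recip q)) ∧
      (n ≤ k →
        c * ((2 : ℝ) ^ (-(((k : ℝ) - 1) / (n : ℝ))) * (n : ℝ) ^ (recip q - recip p))
            ≤ entropyNumber k (lpId p q n) ∧
        entropyNumber k (lpId p q n)
            ≤ C * ((2 : ℝ) ^ (-(((k : ℝ) - 1) / (n : ℝ))) * (n : ℝ) ^ (recip q - recip p)))) ∧
    (q ≤ p → ∃ c C : ℝ, 0 < c ∧ 0 < C ∧ ∀ n k : ℕ, 1 ≤ n → 1 ≤ k →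
      c * ((2 : ℝ) ^ (-(((k : ℝ) - 1) / (n : ℝ))) * (n : ℝ) ^ (recip q - recip p))
          ≤ entropyNumber k (lpId p q n) ∧
      entropyNumber k (lpId p q n)
          ≤ C * ((2 : ℝ) ^ (-(((k : ℝ) - 1) / (n : ℝ))) * (n : ℝ) ^ (recip q - recip p))) := by
  constructor
  · intro hpq
    obtain ⟨c₁, hc₁, hlow⟩ := exists_volume_le_entropyNumber hp hq
    obtain ⟨c₂, hc₂, hlowlog⟩ := exists_logb_le_entropyNumber hp hpq
    obtain ⟨C₁, hC₁, hup⟩ := exists_entropyNumber_le_of_le hp hpq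
    obtain ⟨C₂, hC₂, huplog⟩ := exists_entropyNumber_le_logb_of_le hp hpq
    set c₃ : ℝ := 1 / 2 * (1 / 2 : ℝ) ^ recip q with hc₃_def
    have hc₃ : 0 < c₃ := by positivity
    refine ⟨min c₁ (min c₂ c₃), max 1 (max C₁ C₂), by positivity, by positivity,
      fun n k hn hk => ⟨fun hkn => ⟨?_, ?_⟩, fun hlog hkn => ?_, fun hnk => ⟨?_, ?_⟩⟩⟩
    · rw [mul_one]
      refine ((min_le_right _ _).trans (min_le_right _ _)).trans (half_le_entropyNumber hp hq hk ?_)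
      rw [Real.le_logb_iff_rpow_le one_lt_two (by exact_mod_cast hn), Real.rpow_natCast] at hkn
      exact_mod_cast hkn
    · rw [mul_one]
      exact (entropyNumber_lpId_le_one hp hpq n k).trans (le_max_left _ _)
    · have hL : 0 ≤ Real.logb 2 (1 + (n : ℝ) / (k : ℝ)) :=
        Real.logb_nonneg one_lt_two (le_add_of_nonneg_right (by positivity))
      constructor
      · exact le_trans (by gcongr; exact (min_le_right _ _).trans (min_le_left _ _))
          (hlowlog n k hk hlog hkn)
      · exact (huplog n k hk hkn).trans
          (by gcongr; exact (le_max_right _ _).trans (le_max_right _ _))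
    · exact le_trans (by gcongr; exact min_le_left _ _) (hlow n k hn hk)
    · exact (hup n k hn hnk).trans (by gcongr; exact (le_max_left _ _).trans (le_max_right _ _))
  · intro hqp
    obtain ⟨c, hc, hlow⟩ := exists_volume_le_entropyNumber hp hq
    obtain ⟨C, hC, hup⟩ := exists_entropyNumber_self_le hq
    refine ⟨c, C, hc, hC, fun n k hn hk => ⟨hlow n k hn hk, ?_⟩⟩
    refine (entropyNumber_lpId_le_mul hq hqp hn).trans ?_
    calc (n : ℝ) ^ (recip q - recip p) * entropyNumber k (lpId q q n)
        ≤ (n : ℝ) ^ (recip q - recip p) * (C * (2 : ℝ) ^ (-(((k : ℝ) - 1) / (n : ℝ)))) := by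
          gcongr
          exact hup n k hn hk
      _ = _ := by ring
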